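/- Let $A\in\mathbb C^{n\times n}$ and let $z_1,\dots,z_N\in\mathbb C$ ($N\ge1$) be arbitrary, possibly repeated, points. Let $f$ be an analytic function on an open set $U\subseteq\mathbb C$ (possibly disconnected) that contains the convex hull of $\sigma(A)\cup\{z_1,\dots,z_N\}$, where $\sigma(A)$ is the spectrum of $A$. Let $r=u/v$, where $u,v$ are complex polynomials, $\deg u\le N-1$, $v(z_k)\ne0$ for $k=1,\dots,N$, and $v(\lambda)\ne0$ for $\lambda\in\sigma(A)$. Suppose that $r$ interpolates $f$ at $z_1,\dots,z_N$ counted according to multiplicity: $r^{(j)}(z_k)=f^{(j)}(z_k)$ for $k=1,\dots,N$ and every $0\le j<n_k$, where $n_k$ is the number of repetitions of $z_k$ in the list $z_1,\dots,z_N$. Put $\Omega(z)=\prod_{k=1}^N(z-z_k)$. Then for any norm $\|\cdot\|$ on the complex linear space $\mathbb C^{n\times n}$ the maximum below is attained, and $$\|f(A)-r(A)\|\le\max_{\substack{t\in[0,1]\\ \mu\in\operatorname{co}\{z_1,\dots,z_N\}}}\Bigl\|\Omega(A)[v(A)]^{-1}\frac{(vf)^{(N)}\bigl((1-t)\mu\mathbf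 1+tA\bigr)}{N!}\Bigr\|.$$ Here $\operatorname{co}$ is the convex hull, $\mathbf 1$ is the identity matrix, and a function $g$ analytic in a neighbourhood of $\sigma(B)$ is applied to a matrix $B$ by $g(B)=\frac1{2\pi i}\int_\Gamma g(\lambda)(\lambda\mathbf 1-B)^{-1}\,d\lambda$, where the contour $\Gamma$ encloses $\sigma(B)$ and lies, with its interior, in the domain of $g$. -/

import Mathlib

open Filter Topology

namespace MatrixEstimate

/-- The Cauchy integral `(2πi)⁻¹ ∫_Γ f(z) (z𝟏 - A)⁻¹ dz` (computed entrywise), where the contour `Γ`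
consists of the positively oriented circles of radius `ε` centred at the eigenvalues of `A`. -/
noncomputable def cauchyIntegral {n : ℕ} (f : ℂ → ℂ) (A : Matrix (Fin n) (Fin n) ℂ) (ε : ℝ) :
    Matrix (Fin n) (Fin n) ℂ :=
  ∑ w ∈ A.finite_spectrum.toFinset,
    Matrix.of fun i j =>
      (2 * Real.pi * Complex.I : ℂ)⁻¹ *
        ∮ z in C(w, ε), f z * (z • (1 : Matrix (Fin n) (Fin n) ℂ) - A)⁻¹ i j

/-- The function `f`, analytic at the points of the spectrum of `A`, applied to the matrix `A`:
the Cauchy integral of `f` against the resolvent of `A` over a contour that encloses the spectrum.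
The contour consists of small circles around the eigenvalues; for all sufficiently small radii the
integral has the same value, see `eventually_cauchyIntegral_eq_matrixFun`. -/
noncomputable def matrixFun {n : ℕ} (f : ℂ → ℂ) (A : Matrix (Fin n) (Fin n) ℂ) :
    Matrix (Fin n) (Fin n) ℂ :=
  limUnder (𝓝[>] (0 : ℝ)) (cauchyIntegral f A)

theorem differentiableAt_integrand {n : ℕ} {f : ℂ → ℂ} {A : Matrix (Fin n) (Fin n) ℂ} {z : ℂ}
    (hf : AnalyticAt ℂ f z) (hz : z ∉ spectrum ℂ A) (i j : Fin n) :
    DifferentiableAt ℂ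
      (fun z => f z * (z • (1 : Matrix (Fin n) (Fin n) ℂ) - A)⁻¹ i j) z := by
  have hu : IsUnit (z • (1 : Matrix (Fin n) (Fin n) ℂ) - A) := by
    simpa [spectrum.mem_iff, Algebra.algebraMap_eq_smul_one] using hz
  have hd : (z • (1 : Matrix (Fin n) (Fin n) ℂ) - A).det ≠ 0 :=
    ((Matrix.isUnit_iff_isUnit_det _).1 hu).ne_zero
  have hent : ∀ k l, Differentiable ℂ
      (fun z : ℂ => (z • (1 : Matrix (Fin n) (Fin n) ℂ) - A) k l) := by
    intro k l
    simp only [Matrix.sub_apply, Matrix.smul_apply, smul_eq_mul]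
    fun_prop
  have hdet : ∀ M : ℂ → Matrix (Fin n) (Fin n) ℂ, (∀ k l, Differentiable ℂ fun z => M z k l) →
      Differentiable ℂ (fun z => (M z).det) := by
    intro M hM
    simp only [Matrix.det_apply]
    refine Differentiable.fun_sum fun σ _ => ?_
    refine Differentiable.const_smul ?_ _
    exact Differentiable.fun_finsetProd fun k _ => hM _ _
  refine hf.differentiableAt.mul ?_
  simp only [Matrix.inv_def, Matrix.smul_apply, Ring.inverse_eq_inv', smul_eq_mul,
    Matrix.adjugate_apply]
  refine ((hdet _ hent) z).inv hd |>.mul ?_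
  refine (hdet _ fun k l => ?_) z
  by_cases h : k = j
  · subst h
    simp
  · simpa [Matrix.updateRow_ne h] using hent k l

/-- The value of the Cauchy integral does not depend on the (small) radius of the circles. -/
theorem eventually_cauchyIntegral_eq_matrixFun {n : ℕ} {f : ℂ → ℂ}
    {A : Matrix (Fin n) (Fin n) ℂ} (hf : AnalyticOnNhd ℂ f (spectrum ℂ A)) :
    ∀ᶠ ε in 𝓝[>] (0 : ℝ), cauchyIntegral f A ε = matrixFun f A := by
  have key : ∀ w ∈ A.finite_spectrum.toFinset, ∃ δ > 0, ∀ z, dist z w < δ → z ≠ w →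
      AnalyticAt ℂ f z ∧ z ∉ spectrum ℂ A := by
    intro w hw
    have h1 := (hf w (by simpa using hw)).eventually_analyticAt
    have h2 : ∀ᶠ z in 𝓝 w, z ∉ spectrum ℂ A \ {w} :=
      (A.finite_spectrum.subset Set.sdiff_subset).isClosed.isOpen_compl.mem_nhds (by simp)
    obtain ⟨δ, hδ, h⟩ := Metric.eventually_nhds_iff.1 (h1.and h2)
    exact ⟨δ, hδ, fun z hz hne => ⟨(h hz).1, fun hs => (h hz).2 ⟨hs, hne⟩⟩⟩
  have hδ : ∃ δ > 0, ∀ w ∈ A.finite_spectrum.toFinset, ∀ z, dist z w < δ → z ≠ w →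
      AnalyticAt ℂ f z ∧ z ∉ spectrum ℂ A := by
    have : ∀ᶠ δ in 𝓝[>] (0 : ℝ), ∀ w ∈ A.finite_spectrum.toFinset, ∀ z, dist z w < δ → z ≠ w →
        AnalyticAt ℂ f z ∧ z ∉ spectrum ℂ A := by
      rw [Filter.eventually_all_finset]
      intro w hw
      obtain ⟨δ, hδ, h⟩ := key w hw
      filter_upwards [Ioo_mem_nhdsGT hδ] with ε hε z hz hne
      exact h z (hz.trans hε.2) hne
    obtain ⟨δ, h, h'⟩ := (this.and self_mem_nhdsWithin).exists
    exact ⟨δ, h', h⟩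
  obtain ⟨δ, hδ, h⟩ := hδ
  have hle : ∀ r R : ℝ, 0 < r → r ≤ R → R < δ → cauchyIntegral f A R = cauchyIntegral f A r := by
    intro r R hr hrR hR
    refine Finset.sum_congr rfl fun w hw => ?_
    ext i j
    simp only [Matrix.of_apply]
    congr 1
    have hd : ∀ z ∈ Metric.closedBall w R \ Metric.ball w r, DifferentiableAt ℂ
        (fun z => f z * (z • (1 : Matrix (Fin n) (Fin n) ℂ) - A)⁻¹ i j) z := by
      rintro z ⟨hz1, hz2⟩
      have hne : z ≠ w := by
        rintro rfl
        exact hz2 (Metric.mem_ball_self hr)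
      obtain ⟨ha, hs⟩ := h w hw z (lt_of_le_of_lt (Metric.mem_closedBall.1 hz1) hR) hne
      exact differentiableAt_integrand ha hs i j
    refine Complex.circleIntegral_eq_of_differentiable_on_annulus_off_countable hr hrR
      Set.countable_empty (fun z hz => (hd z hz).continuousAt.continuousWithinAt) ?_
    rintro z ⟨⟨hz1, hz2⟩, -⟩
    exact hd z ⟨Metric.ball_subset_closedBall hz1,
      fun hb => hz2 (Metric.ball_subset_closedBall hb)⟩
  have hconst : ∀ ε ∈ Set.Ioo 0 δ, cauchyIntegral f A ε = cauchyIntegral f A (δ / 2) := by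
    rintro ε ⟨h1, h2⟩
    rcases le_total ε (δ / 2) with h3 | h3
    · exact (hle _ _ h1 h3 (by linarith)).symm
    · exact hle _ _ (by linarith) h3 h2
  have hev : ∀ᶠ ε in 𝓝[>] (0 : ℝ), cauchyIntegral f A ε = cauchyIntegral f A (δ / 2) := by
    filter_upwards [Ioo_mem_nhdsGT hδ] with ε hε using hconst ε hε
  have hlim : matrixFun f A = cauchyIntegral f A (δ / 2) :=
    (tendsto_const_nhds.congr' (hev.mono fun _ h => h.symm)).limUnder_eq
  rw [hlim]
  exact hev

/-- The multiplicity of the point `z k` in the list `z`: the number of its repetitions. -/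
noncomputable def nodeMultiplicity {N : ℕ} (z : Fin N → ℂ) (k : Fin N) : ℕ :=
  Nat.card {i : Fin N // z i = z k}

/-- `r` interpolates `f` at the points `z k`, counted according to their multiplicities. -/
def Interpolates {N : ℕ} (z : Fin N → ℂ) (r f : ℂ → ℂ) : Prop :=
  ∀ k : Fin N, ∀ j < nodeMultiplicity z k, iteratedDeriv j r (z k) = iteratedDeriv j f (z k)

/-- The polynomial `Ω(x) = ∏ (x - z k)`. -/
noncomputable def nodePoly {N : ℕ} (z : Fin N → ℂ) : Polynomial ℂ :=
  ∏ k : Fin N, (Polynomial.X - Polynomial.C (z k))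

/-- The matrix `Ω(A) v(A)⁻¹ (v f)^(N)((1 - t) μ 𝟏 + t A) / N!`. -/
noncomputable def remainderMatrix {n N : ℕ} (A : Matrix (Fin n) (Fin n) ℂ) (z : Fin N → ℂ)
    (v : Polynomial ℂ) (f : ℂ → ℂ) (t : ℝ) (μ : ℂ) : Matrix (Fin n) (Fin n) ℂ :=
  Polynomial.aeval A (nodePoly z) * (Polynomial.aeval A v)⁻¹ *
    ((N.factorial : ℂ)⁻¹ •
      matrixFun (iteratedDeriv N fun x => v.eval x * f x)
        (((1 - (t : ℂ)) * μ) • (1 : Matrix (Fin n) (Fin n) ℂ) + (t : ℂ) • A))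

end MatrixEstimate

/-!
Let `q = v f - u`. Interpolation means that `q = Ω h`, where `h` is the divided difference of `q` at
the nodes, obtained by iterating `dslope`; hence `f(A) - r(A) = Ω(A) v(A)⁻¹ h(A)`. Removing one node
`a` from `q` costs nothing, since along the segment `B_s = a 𝟏 + s (B - a 𝟏)`
`d/ds [s ^ (k + 1) (dslope q a)^(k)(B_s)] = s ^ k q^(k + 1)(B_s)`,
and the mean value inequality bounds `(dslope q a)^(k)(B) / k!` by the largest value of
`q^(k + 1)(B_s) / (k + 1)!`, in any seminorm. The matrices `(1 - t) μ 𝟏 + t A` form a convex set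
that contains the scalar matrices `z_k 𝟏`, so this step can be iterated over all nodes within that
set, and `q^(N) = (v f)^(N)` because `deg u < N`.
-/

namespace MatrixEstimate

section DividedDifference

variable {E : Type*} [NormedAddCommGroup E] [NormedSpace ℂ E] [CompleteSpace E]

theorem analyticAt_iteratedDeriv {g : ℂ → E} {x : ℂ} (hg : AnalyticAt ℂ g x) (k : ℕ) :
    AnalyticAt ℂ (iteratedDeriv k g) x :=
  iteratedDeriv_eq_iterate (f := g) ▸ hg.iterated_deriv k

theorem analyticOnNhd_dslope {g : ℂ → E} {U : Set ℂ} (hU : IsOpen U) (hg : AnalyticOnNhd ℂ g U)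
    {a : ℂ} (ha : a ∈ U) : AnalyticOnNhd ℂ (dslope g a) U :=
  ((Complex.differentiableOn_dslope (hU.mem_nhds ha)).2 hg.differentiableOn).analyticOnNhd hU

theorem eq_add_sub_mul_dslope (g : ℂ → ℂ) (a x : ℂ) : g x = g a + (x - a) * dslope g a x := by
  rw [← smul_eq_mul, sub_smul_dslope, add_sub_cancel]

theorem iteratedDeriv_succ_sub_mul {g : ℂ → ℂ} {x : ℂ} (hg : AnalyticAt ℂ g x) (a : ℂ) (k : ℕ) :
    iteratedDeriv (k + 1) (fun y => (y - a) * g y) x =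
      (x - a) * iteratedDeriv (k + 1) g x + (k + 1) * iteratedDeriv k g x := by
  have hlin : ∀ i, iteratedDeriv (i + 2) (fun y : ℂ => y - a) x = 0 := fun i => by
    simp [iteratedDeriv_succ', iteratedDeriv_const]
  rw [iteratedDeriv_fun_mul (by fun_prop) hg.contDiffAt, Finset.sum_range_succ',
    Finset.sum_range_succ']
  simp [hlin]
  ring

theorem iteratedDeriv_succ_eq_dslope {g : ℂ → ℂ} {U : Set ℂ} (hU : IsOpen U)
    (hg : AnalyticOnNhd ℂ g U) {a x : ℂ} (ha : a ∈ U) (hx : x ∈ U) (k : ℕ) :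
    iteratedDeriv (k + 1) g x = (x - a) * iteratedDeriv (k + 1) (dslope g a) x +
      (k + 1) * iteratedDeriv k (dslope g a) x := by
  rw [← iteratedDeriv_succ_sub_mul (analyticOnNhd_dslope hU hg ha x hx)]
  conv_lhs => rw [funext (eq_add_sub_mul_dslope g a)]
  simp [iteratedDeriv_succ']

/-- The divided difference `q[a₁, …, a_N, x]` of `q` at the list of nodes `a₁, …, a_N`, as a
function of the last argument `x`. Confluent nodes are allowed, since `dslope q a` takes the value
`deriv q a` at `a`. -/
noncomputable def dividedDifference (l : List ℂ) (q : ℂ → E) : ℂ → E :=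
  l.foldl dslope q

theorem analyticOnNhd_dividedDifference {U : Set ℂ} (hU : IsOpen U) {l : List ℂ}
    (hl : ∀ a ∈ l, a ∈ U) {q : ℂ → E} (hq : AnalyticOnNhd ℂ q U) :
    AnalyticOnNhd ℂ (dividedDifference l q) U := by
  induction l generalizing q with
  | nil => exact hq
  | cons a l ih =>
    exact ih (fun b hb => hl b (by simp [hb])) (analyticOnNhd_dslope hU hq (hl a (by simp)))

theorem analyticOrderAt_eq_add_dslope {q : ℂ → ℂ} {a b : ℂ} (hqa : q a = 0)
    (hD : AnalyticAt ℂ (dslope q a) b) :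
    analyticOrderAt q b = (if b = a then 1 else 0) + analyticOrderAt (dslope q a) b := by
  have hfac : q = (fun x => x - a) * dslope q a :=
    funext fun x => by simpa [hqa] using eq_add_sub_mul_dslope q a x
  conv_lhs => rw [hfac, analyticOrderAt_mul (by fun_prop) hD]
  split_ifs with hba
  · rw [hba, analyticOrderAt_id_sub_const_self]
  · rw [analyticOrderAt_id_sub_const_of_ne hba]

theorem eq_prod_mul_dividedDifference {U : Set ℂ} (hU : IsOpen U) {l : List ℂ}
    (hl : ∀ a ∈ l, a ∈ U) {q : ℂ → ℂ} (hq : AnalyticOnNhd ℂ q U)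
    (hord : ∀ a ∈ l, (l.count a : ℕ∞) ≤ analyticOrderAt q a) (x : ℂ) :
    q x = (l.map fun a => x - a).prod * dividedDifference l q x := by
  induction l generalizing q with
  | nil => simp [dividedDifference]
  | cons a l ih =>
    have haU : a ∈ U := hl a (by simp)
    have hqa : q a = 0 := apply_eq_zero_of_analyticOrderAt_ne_zero fun h0 => by
      simpa [h0] using hord a (by simp)
    have hD := analyticOnNhd_dslope hU hq haU
    have hord' : ∀ b ∈ l, (l.count b : ℕ∞) ≤ analyticOrderAt (dslope q a) b := fun b hb => by
      have h := hord b (by simp [hb])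
      rw [analyticOrderAt_eq_add_dslope hqa (hD b (hl b (by simp [hb])))] at h
      obtain rfl | hba := eq_or_ne b a
      · rw [if_pos rfl, List.count_cons_self, add_comm, Nat.cast_add, Nat.cast_one] at h
        exact (ENat.add_le_add_iff_left ENat.one_ne_top).1 h
      · rwa [if_neg hba, zero_add, List.count_cons_of_ne hba.symm] at h
    have hslope := ih (fun b hb => hl b (by simp [hb])) hD hord'
    rw [eq_add_sub_mul_dslope q a x, hqa, hslope, zero_add, ← mul_assoc]
    rfl

end DividedDifference

section SeminormMeanValue

theorem continuous_seminorm {E : Type*} [AddCommGroup E] [Module ℝ E] [TopologicalSpace E]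
    [IsTopologicalAddGroup E] [ContinuousSMul ℝ E] [T2Space E] [FiniteDimensional ℝ E]
    (p : Seminorm ℝ E) : Continuous p := by
  let e : E ≃L[ℝ] EuclideanSpace ℝ (Fin (Module.finrank ℝ E)) := toEuclidean
  have h : Continuous (p.comp e.symm.toLinearMap) :=
    continuousOn_univ.1 ((p.comp e.symm.toLinearMap).convexOn.continuousOn isOpen_univ)
  simpa [Function.comp_def] using h.comp e.continuous

theorem seminorm_image_le_of_seminorm_deriv_le_deriv {E : Type*} [NormedAddCommGroup E]
    [NormedSpace ℝ E] {p : Seminorm ℝ E} (hp : Continuous p) {a b : ℝ} {Ψ Ψ' : ℝ → E}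
    (hΨ : ContinuousOn Ψ (Set.Icc a b))
    (hΨ' : ∀ s ∈ Set.Ico a b, HasDerivWithinAt Ψ (Ψ' s) (Set.Ici s) s) {B B' : ℝ → ℝ}
    (ha : p (Ψ a) ≤ B a) (hB : ContinuousOn B (Set.Icc a b))
    (hB' : ∀ s ∈ Set.Ico a b, HasDerivWithinAt B (B' s) (Set.Ici s) s)
    (bound : ∀ s ∈ Set.Ico a b, p (Ψ' s) ≤ B' s) : ∀ ⦃s⦄, s ∈ Set.Icc a b → p (Ψ s) ≤ B s := by
  refine image_le_of_liminf_slope_right_le_deriv_boundary (hp.comp_continuousOn hΨ) ha hB hB'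
    fun s hs r hr => ?_
  have hslope : Tendsto (fun y => p (slope Ψ s y)) (𝓝[>] s) (𝓝 (p (Ψ' s))) :=
    (hp.tendsto _).comp ((hasDerivWithinAt_iff_tendsto_slope' (by simp)).1 (hΨ' s hs).Ioi_of_Ici)
  refine Eventually.frequently ?_
  filter_upwards [hslope.eventually_lt_const ((bound s hs).trans_lt hr), self_mem_nhdsWithin]
    with y hy hsy
  have hpos : 0 < (y - s)⁻¹ := inv_pos.2 (sub_pos.2 hsy)
  calc slope (p ∘ Ψ) s y ≤ (y - s)⁻¹ * p (Ψ y - Ψ s) :=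
        mul_le_mul_of_nonneg_left ((le_abs_self _).trans (abs_sub_map_le_sub p _ _)) hpos.le
    _ = p (slope Ψ s y) := by
      rw [slope_def_module, map_smul_eq_mul, Real.norm_of_nonneg hpos.le]
    _ < r := hy

end SeminormMeanValue

section FunctionalCalculus

theorem smul_one_sub_mul_sum {K R : Type*} [Field K] [Ring R] [Algebra K R] {M X : R} {k : ℕ}
    (hX : M ^ k * X = 0) {ζ : K} (hζ : ζ ≠ 0) :
    (ζ • 1 - M) * ∑ j ∈ Finset.range k, (1 / ζ ^ (j + 1)) • (M ^ j * X) = X := by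
  have hterm : ∀ j, (ζ • 1 - M) * ((1 / ζ ^ (j + 1)) • (M ^ j * X)) =
      (1 / ζ ^ j) • (M ^ j * X) - (1 / ζ ^ (j + 1)) • (M ^ (j + 1) * X) := fun j => by
    rw [sub_mul, smul_mul_assoc, one_mul, smul_smul, mul_smul_comm, ← mul_assoc, ← pow_succ']
    congr 2
    field_simp
    rw [pow_succ']
  rw [Finset.mul_sum, Finset.sum_congr rfl fun j _ => hterm j, Finset.sum_range_sub', hX]
  simp

variable {n : ℕ} {f g : ℂ → ℂ} {A X : Matrix (Fin n) (Fin n) ℂ}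

theorem inv_mul_eq_sum {w z : ℂ} {k : ℕ} (hX : (A - w • 1) ^ k * X = 0) (hw : w ∈ spectrum ℂ A)
    (hz : z ∉ spectrum ℂ A) :
    (z • (1 : Matrix (Fin n) (Fin n) ℂ) - A)⁻¹ * X =
      ∑ j ∈ Finset.range k, (1 / (z - w) ^ (j + 1)) • ((A - w • 1) ^ j * X) := by
  have hunit : IsUnit (z • (1 : Matrix (Fin n) (Fin n) ℂ) - A) := by
    simpa [spectrum.mem_iff, Algebra.algebraMap_eq_smul_one] using hz
  have hzw : z - w ≠ 0 := fun h => hz (sub_eq_zero.1 h ▸ hw)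
  have hsplit : z • (1 : Matrix (Fin n) (Fin n) ℂ) - A = (z - w) • 1 - (A - w • 1) := by
    rw [sub_smul]
    abel
  conv_lhs => rw [← smul_one_sub_mul_sum hX hzw, ← hsplit]
  rw [← mul_assoc, Matrix.nonsing_inv_mul _ ((Matrix.isUnit_iff_isUnit_det _).1 hunit), one_mul]

/-- `ε` is a radius for which the circles in `cauchyIntegral f A ε` form an admissible contour:
the closed discs of radius `ε` about the eigenvalues of `A` contain no other eigenvalues, and `f` is
analytic on them. -/
structure IsContourRadius (f : ℂ → ℂ) (A : Matrix (Fin n) (Fin n) ℂ) (ε : ℝ) : Prop where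
  pos : 0 < ε
  analyticAt : ∀ w ∈ spectrum ℂ A, ∀ z ∈ Metric.closedBall w ε, AnalyticAt ℂ f z
  eq_of_mem : ∀ w ∈ spectrum ℂ A, ∀ z ∈ Metric.closedBall w ε, z ∈ spectrum ℂ A → z = w

theorem eventually_isContourRadius (hf : AnalyticOnNhd ℂ f (spectrum ℂ A)) :
    ∀ᶠ ε in 𝓝[>] (0 : ℝ), IsContourRadius f A ε := by
  have hball : ∀ᶠ ε in 𝓝[>] (0 : ℝ), ∀ w ∈ spectrum ℂ A, ∀ z ∈ Metric.closedBall w ε,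
      AnalyticAt ℂ f z ∧ z ∉ spectrum ℂ A \ {w} := by
    refine (eventually_all_finite A.finite_spectrum).2 fun w hw => ?_
    have hisolated : ∀ᶠ z in 𝓝 w, z ∉ spectrum ℂ A \ {w} :=
      (A.finite_spectrum.subset Set.sdiff_subset).isClosed.isOpen_compl.mem_nhds (by simp)
    obtain ⟨δ, hδ, h⟩ :=
      Metric.eventually_nhds_iff.1 ((hf w hw).eventually_analyticAt.and hisolated)
    filter_upwards [Ioo_mem_nhdsGT hδ] with ε hε z hz
    exact h (lt_of_le_of_lt (Metric.mem_closedBall.1 hz) hε.2)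
  filter_upwards [hball, self_mem_nhdsWithin] with ε h hε
  exact ⟨hε, fun w hw z hz => (h w hw z hz).1,
    fun w hw z hz hzs => by_contra fun hne => (h w hw z hz).2 ⟨hzs, hne⟩⟩

namespace IsContourRadius

variable {ε : ℝ}

theorem notMem_spectrum (hε : IsContourRadius f A ε) {w z : ℂ} (hw : w ∈ spectrum ℂ A)
    (hz : z ∈ Metric.sphere w ε) : z ∉ spectrum ℂ A := fun hzs => by
  rw [hε.eq_of_mem w hw z (Metric.sphere_subset_closedBall hz) hzs] at hz
  simp [hε.pos.ne] at hz

theorem cauchyIntegral_mul_apply (hε : IsContourRadius f A ε) (X : Matrix (Fin n) (Fin n) ℂ)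
    (i m : Fin n) :
    (cauchyIntegral f A ε * X) i m = ∑ w ∈ A.finite_spectrum.toFinset,
      (2 * Real.pi * Complex.I : ℂ)⁻¹ *
        ∮ z in C(w, ε), f z * ((z • (1 : Matrix (Fin n) (Fin n) ℂ) - A)⁻¹ * X) i m := by
  rw [cauchyIntegral, Finset.sum_mul, Matrix.sum_apply]
  refine Finset.sum_congr rfl fun w hw => ?_
  have hint : ∀ l, CircleIntegrable (fun z =>
      X l m * (f z * (z • (1 : Matrix (Fin n) (Fin n) ℂ) - A)⁻¹ i l)) w ε := fun l => by
    refine ContinuousOn.circleIntegrable hε.pos.le (continuousOn_const.mul fun z hz => ?_)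
    rw [Set.Finite.mem_toFinset] at hw
    exact (differentiableAt_integrand (hε.analyticAt w hw z (Metric.sphere_subset_closedBall hz))
      (hε.notMem_spectrum hw hz) i l).continuousAt.continuousWithinAt
  calc _ = (2 * Real.pi * Complex.I : ℂ)⁻¹ * ∑ l, ∮ z in C(w, ε),
        X l m * (f z * (z • (1 : Matrix (Fin n) (Fin n) ℂ) - A)⁻¹ i l) := by
        rw [Matrix.mul_apply, Finset.mul_sum]
        refine Finset.sum_congr rfl fun l _ => ?_
        rw [Matrix.of_apply, circleIntegral.integral_const_mul]
        ring
    _ = _ := by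
      rw [← circleIntegral.integral_fun_sum fun l _ => hint l]
      simp only [Matrix.mul_apply, Finset.mul_sum, mul_comm (X _ m), mul_assoc]

theorem circleIntegral_one_div_sub_pow_smul (hε : IsContourRadius f A ε) {w w' : ℂ}
    (hw : w ∈ spectrum ℂ A) (hw' : w' ∈ spectrum ℂ A) (j : ℕ) :
    (2 * Real.pi * Complex.I : ℂ)⁻¹ * ∮ z in C(w', ε), (1 / (z - w) ^ (j + 1)) • f z =
      if w' = w then (j.factorial : ℂ)⁻¹ * iteratedDeriv j f w else 0 := by
  split_ifs with h
  · subst h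
    have hd : DifferentiableOn ℂ f (Metric.closedBall w' ε) := fun z hz =>
      (hε.analyticAt w' hw z hz).differentiableAt.differentiableWithinAt
    have := Complex.two_pi_I_ne_zero
    rw [hd.circleIntegral_one_div_sub_center_pow_smul hε.pos, smul_eq_mul]
    field_simp
  · have hd : ∀ z ∈ Metric.closedBall w' ε,
        DifferentiableAt ℂ (fun z => (1 / (z - w) ^ (j + 1)) • f z) z := fun z hz => by
      have hzw : z - w ≠ 0 := fun h0 =>
        h (hε.eq_of_mem w' hw' w (sub_eq_zero.1 h0 ▸ hz) hw).symm
      have hfz := (hε.analyticAt w' hw' z hz).differentiableAt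
      fun_prop (disch := exact pow_ne_zero _ hzw)
    rw [Complex.circleIntegral_eq_zero_of_differentiable_on_off_countable hε.pos.le
      Set.countable_empty (fun z hz => (hd z hz).continuousAt.continuousWithinAt)
      (fun z hz => hd z (Metric.ball_subset_closedBall hz.1)), mul_zero]

theorem circleIntegral_mul_inv_mul_apply (hε : IsContourRadius f A ε) {w w' : ℂ}
    (hw : w ∈ spectrum ℂ A) (hw' : w' ∈ spectrum ℂ A) {k : ℕ} (hX : (A - w • 1) ^ k * X = 0)
    (i m : Fin n) :
    ∮ z in C(w', ε), f z * ((z • (1 : Matrix (Fin n) (Fin n) ℂ) - A)⁻¹ * X) i m =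
      ∑ j ∈ Finset.range k, ((A - w • 1) ^ j * X) i m *
        ∮ z in C(w', ε), (1 / (z - w) ^ (j + 1)) • f z := by
  have hint : ∀ j, CircleIntegrable (fun z =>
      ((A - w • 1) ^ j * X) i m * ((1 / (z - w) ^ (j + 1)) • f z)) w' ε := fun j => by
    refine ContinuousOn.circleIntegrable hε.pos.le fun z hz => ContinuousAt.continuousWithinAt ?_
    have hzw : z - w ≠ 0 := fun h => hε.notMem_spectrum hw' hz (sub_eq_zero.1 h ▸ hw)
    have hfz := (hε.analyticAt w' hw' z (Metric.sphere_subset_closedBall hz)).continuousAt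
    fun_prop (disch := exact pow_ne_zero _ hzw)
  simp only [← circleIntegral.integral_const_mul]
  rw [← circleIntegral.integral_fun_sum fun j _ => hint j]
  refine circleIntegral.integral_congr hε.pos.le fun z hz => ?_
  simp only [inv_mul_eq_sum hX hw (hε.notMem_spectrum hw' hz), Matrix.sum_apply,
    Matrix.smul_apply, smul_eq_mul, Finset.mul_sum]
  exact Finset.sum_congr rfl fun j _ => by ring

end IsContourRadius

theorem matrixFun_mul_eq_sum (hf : AnalyticOnNhd ℂ f (spectrum ℂ A)) {w : ℂ}
    (hw : w ∈ spectrum ℂ A) {k : ℕ} (hX : (A - w • 1) ^ k * X = 0) :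
    matrixFun f A * X = ∑ j ∈ Finset.range k,
      ((j.factorial : ℂ)⁻¹ * iteratedDeriv j f w) • ((A - w • 1) ^ j * X) := by
  obtain ⟨ε, hcauchy, hε⟩ :=
    ((eventually_cauchyIntegral_eq_matrixFun hf).and (eventually_isContourRadius hf)).exists
  ext i m
  rw [← hcauchy, hε.cauchyIntegral_mul_apply, Matrix.sum_apply]
  calc _ = ∑ w' ∈ A.finite_spectrum.toFinset, ∑ j ∈ Finset.range k,
        ((A - w • 1) ^ j * X) i m *
          if w' = w then (j.factorial : ℂ)⁻¹ * iteratedDeriv j f w else 0 := by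
        refine Finset.sum_congr rfl fun w' hw' => ?_
        have hw' : w' ∈ spectrum ℂ A := by simpa using hw'
        rw [hε.circleIntegral_mul_inv_mul_apply hw hw' hX, Finset.mul_sum]
        refine Finset.sum_congr rfl fun j _ => ?_
        rw [mul_left_comm, hε.circleIntegral_one_div_sub_pow_smul hw hw']
    _ = _ := by
      rw [Finset.sum_comm]
      simp [hw, mul_comm]

/-- A resolution of the identity `∑ P w = 1` over the eigenvalues `w` of `A`, in which the columns
of `P w` are generalized eigenvectors of `A` for `w`. It reduces an identity between functions of
`A` to its jets at the eigenvalues; the `P w` are not required to be projections. -/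
structure IsSpectralResolution (A : Matrix (Fin n) (Fin n) ℂ)
    (P : ℂ → Matrix (Fin n) (Fin n) ℂ) : Prop where
  sum_eq_one : ∑ w ∈ A.finite_spectrum.toFinset, P w = 1
  pow_mul_eq_zero : ∀ w ∈ spectrum ℂ A, (A - w • 1) ^ n * P w = 0

theorem aeval_prod_X_sub_C_pow_eq_zero (A : Matrix (Fin n) (Fin n) ℂ) :
    Polynomial.aeval A (∏ w ∈ A.finite_spectrum.toFinset,
      (Polynomial.X - Polynomial.C w) ^ n) = 0 := by
  have hroots : A.charpoly.roots.toFinset ⊆ A.finite_spectrum.toFinset := fun w hw => by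
    simp only [Multiset.mem_toFinset, Polynomial.mem_roots A.charpoly_monic.ne_zero] at hw
    simpa using Matrix.mem_spectrum_iff_isRoot_charpoly.2 hw
  have hcount : ∀ w, A.charpoly.roots.count w ≤ n := fun w => by
    simpa using (Multiset.count_le_card w _).trans (Polynomial.card_roots' A.charpoly)
  have hdvd : A.charpoly ∣ ∏ w ∈ A.finite_spectrum.toFinset,
      (Polynomial.X - Polynomial.C w) ^ n := by
    rw [(IsAlgClosed.splits A.charpoly).eq_prod_roots, A.charpoly_monic.leadingCoeff,
      Polynomial.C_1, one_mul, Finset.prod_multiset_map_count]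
    exact (Finset.prod_dvd_prod_of_dvd _ _ fun w _ => pow_dvd_pow _ (hcount w)).trans
      (Finset.prod_dvd_prod_of_subset _ _ _ hroots)
  obtain ⟨c, hc⟩ := hdvd
  rw [hc, map_mul, Matrix.aeval_self_charpoly, zero_mul]

theorem exists_isSpectralResolution (A : Matrix (Fin n) (Fin n) ℂ) :
    ∃ P, IsSpectralResolution A P := by
  rcases Nat.eq_zero_or_pos n with rfl | hn
  · exact ⟨0, Subsingleton.elim _ _, fun w _ => Subsingleton.elim _ _⟩
  have : NeZero n := ⟨hn.ne'⟩
  set W := A.finite_spectrum.toFinset with hW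
  have hne : W.Nonempty := (Set.Finite.toFinset_nonempty _).2
    (spectrum.nonempty_of_isAlgClosed_of_finiteDimensional ℂ A)
  let s : ℂ → Polynomial ℂ := fun w => (Polynomial.X - Polynomial.C w) ^ n
  obtain ⟨q, hq⟩ := (exists_sum_eq_one_iff_pairwise_coprime (s := s) hne).2 fun x y hxy =>
    (Polynomial.pairwise_coprime_X_sub_C Subtype.val_injective hxy).pow
  refine ⟨fun w => Polynomial.aeval A (q w * ∏ j ∈ W \ {w}, s j), ?_, fun w hw => ?_⟩
  · rw [← map_sum, hq, map_one]
  · have hpow : (A - w • (1 : Matrix (Fin n) (Fin n) ℂ)) ^ n = Polynomial.aeval A (s w) := by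
      simp [s, Algebra.algebraMap_eq_smul_one]
    have hprod : (∏ j ∈ W \ {w}, s j) * s w = ∏ j ∈ W, s j := by
      simpa using Finset.prod_sdiff (f := s) (Finset.singleton_subset_iff.2 (by simpa [hW]))
    rw [hpow, ← map_mul, mul_left_comm, mul_comm (s w), hprod, map_mul,
      aeval_prod_X_sub_C_pow_eq_zero, mul_zero]

namespace IsSpectralResolution

variable {P : ℂ → Matrix (Fin n) (Fin n) ℂ}

theorem pow_mul_eq_zero_of_le (hP : IsSpectralResolution A P) {w : ℂ} (hw : w ∈ spectrum ℂ A)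
    {k : ℕ} (hk : n ≤ k) : (A - w • 1) ^ k * P w = 0 := by
  rw [← Nat.sub_add_cancel hk, pow_add, mul_assoc, hP.pow_mul_eq_zero w hw, mul_zero]

theorem sum_mul (hP : IsSpectralResolution A P) (X : Matrix (Fin n) (Fin n) ℂ) :
    ∑ w ∈ A.finite_spectrum.toFinset, X * P w = X := by
  rw [← Finset.mul_sum, hP.sum_eq_one, mul_one]

theorem eq_of_forall_mul_eq (hP : IsSpectralResolution A P) {X Y : Matrix (Fin n) (Fin n) ℂ}
    (h : ∀ w ∈ spectrum ℂ A, X * P w = Y * P w) : X = Y := by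
  rw [← hP.sum_mul X, ← hP.sum_mul Y]
  exact Finset.sum_congr rfl fun w hw => h w (by simpa using hw)

end IsSpectralResolution

theorem matrixFun_congr (hf : AnalyticOnNhd ℂ f (spectrum ℂ A))
    (hfg : ∀ w ∈ spectrum ℂ A, f =ᶠ[𝓝 w] g) : matrixFun f A = matrixFun g A := by
  obtain ⟨P, hP⟩ := exists_isSpectralResolution A
  have hg : AnalyticOnNhd ℂ g (spectrum ℂ A) := fun w hw => (hf w hw).congr (hfg w hw)
  refine hP.eq_of_forall_mul_eq fun w hw => ?_
  rw [matrixFun_mul_eq_sum hf hw (hP.pow_mul_eq_zero w hw),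
    matrixFun_mul_eq_sum hg hw (hP.pow_mul_eq_zero w hw)]
  simp only [(hfg w hw).iteratedDeriv_eq]

theorem matrixFun_add (hf : AnalyticOnNhd ℂ f (spectrum ℂ A))
    (hg : AnalyticOnNhd ℂ g (spectrum ℂ A)) :
    matrixFun (f + g) A = matrixFun f A + matrixFun g A := by
  obtain ⟨P, hP⟩ := exists_isSpectralResolution A
  refine hP.eq_of_forall_mul_eq fun w hw => ?_
  have hw' := hP.pow_mul_eq_zero w hw
  rw [add_mul, matrixFun_mul_eq_sum (hf.add hg) hw hw', matrixFun_mul_eq_sum hf hw hw',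
    matrixFun_mul_eq_sum hg hw hw', ← Finset.sum_add_distrib]
  refine Finset.sum_congr rfl fun j _ => ?_
  rw [← add_smul, ← mul_add, iteratedDeriv_add (hf w hw).contDiffAt (hg w hw).contDiffAt]

theorem inv_factorial_mul_iteratedDeriv_mul {x : ℂ} (hf : AnalyticAt ℂ f x)
    (hg : AnalyticAt ℂ g x) (k : ℕ) :
    (k.factorial : ℂ)⁻¹ * iteratedDeriv k (f * g) x =
      ∑ i ∈ Finset.range (k + 1), ((i.factorial : ℂ)⁻¹ * iteratedDeriv i f x) *
        (((k - i).factorial : ℂ)⁻¹ * iteratedDeriv (k - i) g x) := by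
  rw [iteratedDeriv_mul hf.contDiffAt hg.contDiffAt, Finset.mul_sum]
  refine Finset.sum_congr rfl fun i hi => ?_
  rw [Nat.cast_choose ℂ (Finset.mem_range_succ_iff.1 hi)]
  have := Nat.cast_ne_zero (R := ℂ).2 k.factorial_ne_zero
  field_simp

theorem matrixFun_mul (hf : AnalyticOnNhd ℂ f (spectrum ℂ A))
    (hg : AnalyticOnNhd ℂ g (spectrum ℂ A)) :
    matrixFun (f * g) A = matrixFun f A * matrixFun g A := by
  obtain ⟨P, hP⟩ := exists_isSpectralResolution A
  refine hP.eq_of_forall_mul_eq fun w hw => ?_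
  have hw' := hP.pow_mul_eq_zero w hw
  set M := A - w • (1 : Matrix (Fin n) (Fin n) ℂ)
  set a : ℕ → ℂ := fun i => (i.factorial : ℂ)⁻¹ * iteratedDeriv i f w
  set b : ℕ → ℂ := fun i => (i.factorial : ℂ)⁻¹ * iteratedDeriv i g w
  have hpow : ∀ j ∈ Finset.range n, M ^ (n - j) * (M ^ j * P w) = 0 := fun j hj => by
    rw [← mul_assoc, ← pow_add, Nat.sub_add_cancel (Finset.mem_range.1 hj).le, hw']
  calc matrixFun (f * g) A * P w
      = ∑ k ∈ Finset.range n, ∑ j ∈ Finset.range (k + 1),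
          (b j * a (k - j)) • (M ^ (j + (k - j)) * P w) := by
        rw [matrixFun_mul_eq_sum (f := f * g) (hf.mul hg) hw hw']
        refine Finset.sum_congr rfl fun k _ => ?_
        rw [mul_comm f, inv_factorial_mul_iteratedDeriv_mul (hg w hw) (hf w hw), Finset.sum_smul]
        refine Finset.sum_congr rfl fun j hj => ?_
        rw [Nat.add_sub_cancel' (Finset.mem_range_succ_iff.1 hj)]
    _ = ∑ j ∈ Finset.range n, ∑ i ∈ Finset.range (n - j), (b j * a i) • (M ^ (j + i) * P w) :=
        Finset.sum_range_diag_flip n fun j i => (b j * a i) • (M ^ (j + i) * P w)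
    _ = ∑ j ∈ Finset.range n, b j • (matrixFun f A * (M ^ j * P w)) := by
        refine Finset.sum_congr rfl fun j hj => ?_
        rw [matrixFun_mul_eq_sum hf hw (hpow j hj), Finset.smul_sum]
        refine Finset.sum_congr rfl fun i _ => ?_
        rw [smul_smul, ← mul_assoc (_ ^ i), ← pow_add, add_comm i]
    _ = matrixFun f A * matrixFun g A * P w := by
        simp only [mul_assoc, matrixFun_mul_eq_sum hg hw hw', Finset.mul_sum, mul_smul_comm]
        rfl

theorem matrixFun_const (c : ℂ) : matrixFun (fun _ => c) A = c • 1 := by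
  obtain ⟨P, hP⟩ := exists_isSpectralResolution A
  refine hP.eq_of_forall_mul_eq fun w hw => ?_
  rw [matrixFun_mul_eq_sum analyticOnNhd_const hw (hP.pow_mul_eq_zero_of_le hw n.le_succ),
    Finset.sum_range_succ']
  simp [iteratedDeriv_const]

theorem matrixFun_id : matrixFun (fun x => x) A = A := by
  obtain ⟨P, hP⟩ := exists_isSpectralResolution A
  refine hP.eq_of_forall_mul_eq fun w hw => ?_
  rw [matrixFun_mul_eq_sum analyticOnNhd_id hw
    (hP.pow_mul_eq_zero_of_le hw (n.le_add_right 2)), Finset.sum_range_succ',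
    Finset.sum_range_succ']
  simp [iteratedDeriv_succ', iteratedDeriv_const, sub_mul]

theorem analyticOnNhd_eval (p : Polynomial ℂ) (s : Set ℂ) :
    AnalyticOnNhd ℂ (fun x => p.eval x) s := fun x _ =>
  AnalyticOnNhd.eval_polynomial p x (Set.mem_univ x)

theorem matrixFun_eval (p : Polynomial ℂ) :
    matrixFun (fun x => p.eval x) A = Polynomial.aeval A p := by
  induction p using Polynomial.induction_on with
  | C c => simpa [Algebra.algebraMap_eq_smul_one] using matrixFun_const c
  | add p q hp hq =>
    simp only [Polynomial.eval_add, map_add, ← hp, ← hq]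
    exact matrixFun_add (analyticOnNhd_eval p _) (analyticOnNhd_eval q _)
  | monomial k c ih =>
    rw [pow_succ, ← mul_assoc, map_mul, ← ih, Polynomial.aeval_X]
    refine Eq.trans ?_ ((matrixFun_mul (analyticOnNhd_eval _ _) analyticOnNhd_id).trans
      (congrArg _ matrixFun_id))
    exact congrArg (matrixFun · A) (funext fun x => by simp [mul_assoc])

theorem isUnit_aeval {v : Polynomial ℂ} (hv : ∀ w ∈ spectrum ℂ A, v.eval w ≠ 0) :
    IsUnit (Polynomial.aeval A v) := by
  rcases Nat.eq_zero_or_pos n with rfl | hn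
  · exact isUnit_of_subsingleton _
  have : NeZero n := ⟨hn.ne'⟩
  rw [← spectrum.zero_notMem_iff ℂ, spectrum.map_polynomial_aeval_of_nonempty A v
    (spectrum.nonempty_of_isAlgClosed_of_finiteDimensional ℂ A)]
  rintro ⟨w, hw, h0⟩
  exact hv w hw h0

theorem matrixFun_sub_div_eq {h : ℂ → ℂ} {u v p : Polynomial ℂ}
    (hf : AnalyticOnNhd ℂ f (spectrum ℂ A)) (hh : AnalyticOnNhd ℂ h (spectrum ℂ A))
    (hv : ∀ w ∈ spectrum ℂ A, v.eval w ≠ 0)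
    (hfactor : ∀ x, v.eval x * f x - u.eval x = p.eval x * h x) :
    matrixFun f A - matrixFun (fun x => u.eval x / v.eval x) A =
      Polynomial.aeval A p * (Polynomial.aeval A v)⁻¹ * matrixFun h A := by
  obtain ⟨V, hV⟩ := isUnit_aeval hv
  have hu := analyticOnNhd_eval u (spectrum ℂ A)
  have hv' := analyticOnNhd_eval v (spectrum ℂ A)
  have hp := analyticOnNhd_eval p (spectrum ℂ A)
  have hvf : V * matrixFun f A = Polynomial.aeval A u + Polynomial.aeval A p * matrixFun h A := by
    rw [hV, ← matrixFun_eval v, ← matrixFun_eval u, ← matrixFun_eval p, ← matrixFun_mul hv' hf,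
      ← matrixFun_mul hp hh, ← matrixFun_add (g := _ * h) hu (hp.mul hh)]
    exact congrArg (matrixFun · A) (funext fun x => eq_add_of_sub_eq' (hfactor x))
  have hvr : V * matrixFun (fun x => u.eval x / v.eval x) A = Polynomial.aeval A u := by
    rw [hV, ← matrixFun_eval v, ← matrixFun_eval u, ← matrixFun_mul hv' (hu.div hv' hv)]
    refine matrixFun_congr (hv'.mul (hu.div hv' hv)) fun w hw => ?_
    filter_upwards [(hv' w hw).continuousAt.eventually_ne (hv w hw)] with x hx
    exact mul_div_cancel₀ _ hx
  have hcomm : Commute (Polynomial.aeval A p) (V⁻¹ : (Matrix (Fin n) (Fin n) ℂ)ˣ) :=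
    Commute.units_inv_right (hV ▸ (Commute.all p v).map (Polynomial.aeval A))
  rw [← hV, ← Matrix.coe_units_inv, hcomm.eq, mul_assoc, Units.eq_inv_mul_iff_mul_eq, mul_sub,
    hvf, hvr, add_sub_cancel_left]

theorem spectrum_smul_one_add_smul (A : Matrix (Fin n) (Fin n) ℂ) (c t : ℂ) :
    spectrum ℂ (c • (1 : Matrix (Fin n) (Fin n) ℂ) + t • A) =
      (fun w => c + t * w) '' spectrum ℂ A := by
  rcases Nat.eq_zero_or_pos n with rfl | hn
  · simp [spectrum.of_subsingleton]
  have : NeZero n := ⟨hn.ne'⟩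
  have h := spectrum.map_polynomial_aeval_of_nonempty A
    (Polynomial.C c + Polynomial.C t * Polynomial.X)
    (spectrum.nonempty_of_isAlgClosed_of_finiteDimensional ℂ A)
  simpa [Algebra.algebraMap_eq_smul_one] using h

theorem IsSpectralResolution.matrixFun_smul_one_add_smul {P : ℂ → Matrix (Fin n) (Fin n) ℂ}
    (hP : IsSpectralResolution A P) {c t : ℂ}
    (hg : ∀ w ∈ spectrum ℂ A, AnalyticAt ℂ g (c + t * w)) :
    matrixFun g (c • (1 : Matrix (Fin n) (Fin n) ℂ) + t • A) =
      ∑ w ∈ A.finite_spectrum.toFinset, ∑ j ∈ Finset.range n,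
        (t ^ j * iteratedDeriv j g (c + t * w)) •
          ((j.factorial : ℂ)⁻¹ • ((A - w • 1) ^ j * P w)) := by
  set C := c • (1 : Matrix (Fin n) (Fin n) ℂ) + t • A with hC
  have hσ : spectrum ℂ C = (fun w => c + t * w) '' spectrum ℂ A := spectrum_smul_one_add_smul A c t
  have hg' : AnalyticOnNhd ℂ g (spectrum ℂ C) := by
    rw [hσ]
    exact Set.forall_mem_image.2 hg
  rw [← hP.sum_mul (matrixFun g C)]
  refine Finset.sum_congr rfl fun w hw => ?_
  have hw : w ∈ spectrum ℂ A := by simpa using hw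
  have hpow : ∀ j, (C - (c + t * w) • 1) ^ j * P w = t ^ j • ((A - w • 1) ^ j * P w) := fun j => by
    rw [← smul_mul_assoc, ← smul_pow, hC]
    congr 2
    module
  rw [matrixFun_mul_eq_sum hg' (hσ ▸ Set.mem_image_of_mem _ hw)
    (by rw [hpow, hP.pow_mul_eq_zero w hw, smul_zero])]
  refine Finset.sum_congr rfl fun j _ => ?_
  rw [hpow, smul_smul, smul_smul]
  congr 1
  ring

attribute [local instance] Matrix.normedAddCommGroup Matrix.normedSpace

theorem continuousOn_matrixFun_smul_one_add_smul (A : Matrix (Fin n) (Fin n) ℂ) (g : ℂ → ℂ) :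
    ContinuousOn
      (fun p : ℂ × ℂ => matrixFun g (p.1 • (1 : Matrix (Fin n) (Fin n) ℂ) + p.2 • A))
      {p | ∀ w ∈ spectrum ℂ A, AnalyticAt ℂ g (p.1 + p.2 * w)} := by
  obtain ⟨P, hP⟩ := exists_isSpectralResolution A
  refine ContinuousOn.congr ?_ fun p hp => hP.matrixFun_smul_one_add_smul hp
  refine continuousOn_finsetSum _ fun w hw => continuousOn_finsetSum _ fun j _ => ?_
  refine ContinuousOn.fun_smul (ContinuousOn.fun_mul (by fun_prop) fun p hp => ?_)
    continuousOn_const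
  have hj := (analyticAt_iteratedDeriv (hp w (by simpa using hw)) j).continuousAt
  exact (hj.comp_of_eq (f := fun p : ℂ × ℂ => p.1 + p.2 * w) (by fun_prop) rfl).continuousWithinAt

theorem hasDerivAt_pow_mul_iteratedDeriv {a w s : ℂ} (hg : AnalyticAt ℂ g (a + s * w)) (j : ℕ) :
    HasDerivAt (fun s => s ^ j * iteratedDeriv j g (a + s * w))
      (j * s ^ (j - 1) * iteratedDeriv j g (a + s * w) +
        s ^ j * (iteratedDeriv (j + 1) g (a + s * w) * w)) s := by
  have houter : HasDerivAt (iteratedDeriv j g) (iteratedDeriv (j + 1) g (a + s * w))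
      (a + s * w) := by
    rw [iteratedDeriv_succ]
    exact (analyticAt_iteratedDeriv hg j).differentiableAt.hasDerivAt
  have hinner : HasDerivAt (fun s => a + s * w) w s := by
    simpa using ((hasDerivAt_id s).mul_const w).const_add a
  exact (hasDerivAt_pow j s).fun_mul (houter.comp_of_eq s hinner rfl)

theorem mul_inv_factorial_smul_pow_mul (A X : Matrix (Fin n) (Fin n) ℂ) (w : ℂ) (j : ℕ) :
    A * ((j.factorial : ℂ)⁻¹ • ((A - w • 1) ^ j * X)) =
      w • ((j.factorial : ℂ)⁻¹ • ((A - w • 1) ^ j * X)) +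
        (j + 1 : ℂ) • (((j + 1).factorial : ℂ)⁻¹ • ((A - w • 1) ^ (j + 1) * X)) := by
  have hcoeff : (j + 1 : ℂ) * ((j + 1).factorial : ℂ)⁻¹ = (j.factorial : ℂ)⁻¹ := by
    have := Nat.cast_add_one_ne_zero (R := ℂ) j
    rw [Nat.factorial_succ, Nat.cast_mul, Nat.cast_succ, mul_inv, mul_inv_cancel_left₀ this]
  rw [smul_smul _ _ ((A - w • 1) ^ (j + 1) * X), hcoeff, pow_succ', mul_assoc (A - w • 1),
    sub_mul, smul_mul_assoc, one_mul, mul_smul_comm]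
  module

theorem sum_range_deriv_smul_eq_mul_sum {R : Type*} [Ring R] [Algebra ℂ R] {M : R} {Y : ℕ → R}
    {w : ℂ} (hY : ∀ j, M * Y j = w • Y j + (j + 1 : ℂ) • Y (j + 1)) {k : ℕ} (hk : Y k = 0) (s : ℂ)
    (d : ℕ → ℂ) :
    ∑ j ∈ Finset.range k, (j * s ^ (j - 1) * d j + s ^ j * (d (j + 1) * w)) • Y j =
      M * ∑ j ∈ Finset.range k, (s ^ j * d (j + 1)) • Y j := by
  have hshift : ∑ j ∈ Finset.range k, (j * s ^ (j - 1) * d j) • Y j =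
      ∑ j ∈ Finset.range k, ((j + 1) * s ^ j * d (j + 1)) • Y (j + 1) := by
    simpa [Finset.sum_range_succ', hk] using
      (Finset.sum_range_succ (fun j => (j * s ^ (j - 1) * d j) • Y j) k).symm
  simp only [add_smul _ _ (Y _), Finset.sum_add_distrib]
  rw [hshift, ← Finset.sum_add_distrib, Finset.mul_sum]
  refine Finset.sum_congr rfl fun j _ => ?_
  rw [mul_smul_comm, hY]
  module

theorem hasDerivAt_matrixFun_smul_one_add_smul {M : Matrix (Fin n) (Fin n) ℂ} {a s : ℂ}
    (hg : AnalyticOnNhd ℂ g (spectrum ℂ (a • (1 : Matrix (Fin n) (Fin n) ℂ) + s • M))) :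
    HasDerivAt (fun s => matrixFun g (a • (1 : Matrix (Fin n) (Fin n) ℂ) + s • M))
      (M * matrixFun (deriv g) (a • 1 + s • M)) s := by
  rw [spectrum_smul_one_add_smul] at hg
  have hg : ∀ w ∈ spectrum ℂ M, AnalyticAt ℂ g (a + s * w) := Set.forall_mem_image.1 hg
  obtain ⟨P, hP⟩ := exists_isSpectralResolution M
  have hjets : ∀ᶠ s in 𝓝 s, ∀ w ∈ spectrum ℂ M, AnalyticAt ℂ g (a + s * w) :=
    (eventually_all_finite M.finite_spectrum).2 fun w hw =>
      (show Continuous fun s => a + s * w by fun_prop).continuousAt.eventually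
        (hg w hw).eventually_analyticAt
  refine HasDerivAt.congr_of_eventuallyEq ?_
    (hjets.mono fun s hs => hP.matrixFun_smul_one_add_smul hs)
  rw [hP.matrixFun_smul_one_add_smul fun w hw => (hg w hw).deriv, Finset.mul_sum]
  refine HasDerivAt.fun_sum fun w hw => ?_
  have hw : w ∈ spectrum ℂ M := by simpa using hw
  simp only [← iteratedDeriv_succ']
  rw [← sum_range_deriv_smul_eq_mul_sum (mul_inv_factorial_smul_pow_mul M (P w) w)
    (by rw [hP.pow_mul_eq_zero w hw, smul_zero]) s fun j => iteratedDeriv j g (a + s * w)]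
  exact HasDerivAt.fun_sum fun j _ =>
    (hasDerivAt_pow_mul_iteratedDeriv (hg w hw) j).smul_const _

section DividedDifferenceEstimate

variable {U : Set ℂ} {q : ℂ → ℂ} {a : ℂ}

theorem matrixFun_iteratedDeriv_succ (hU : IsOpen U) (hq : AnalyticOnNhd ℂ q U) (ha : a ∈ U)
    (hAU : spectrum ℂ A ⊆ U) (k : ℕ) :
    matrixFun (iteratedDeriv (k + 1) q) A =
      (A - a • 1) * matrixFun (iteratedDeriv (k + 1) (dslope q a)) A +
        (k + 1 : ℂ) • matrixFun (iteratedDeriv k (dslope q a)) A := by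
  have hD : ∀ j, AnalyticOnNhd ℂ (iteratedDeriv j (dslope q a)) (spectrum ℂ A) := fun j x hx =>
    analyticAt_iteratedDeriv (analyticOnNhd_dslope hU hq ha x (hAU hx)) j
  set lin : ℂ → ℂ := fun x => (Polynomial.X - Polynomial.C a).eval x
  set const : ℂ → ℂ := fun _ => k + 1
  have hlin : AnalyticOnNhd ℂ lin (spectrum ℂ A) := analyticOnNhd_eval _ _
  have hconst : AnalyticOnNhd ℂ const (spectrum ℂ A) := analyticOnNhd_const
  calc matrixFun (iteratedDeriv (k + 1) q) A
      = matrixFun (lin * iteratedDeriv (k + 1) (dslope q a) +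
          const * iteratedDeriv k (dslope q a)) A := by
        refine matrixFun_congr (fun x hx => analyticAt_iteratedDeriv (hq x (hAU hx)) _)
          fun x hx => ?_
        filter_upwards [hU.mem_nhds (hAU hx)] with y hy
        simpa [lin, const] using iteratedDeriv_succ_eq_dslope hU hq ha hy k
    _ = _ := by
      rw [matrixFun_add (f := lin * _) (g := const * _) (hlin.mul (hD _)) (hconst.mul (hD _)),
        matrixFun_mul hlin (hD _),
        matrixFun_mul hconst (hD _), matrixFun_eval, matrixFun_const, smul_one_mul]
      simp [Algebra.algebraMap_eq_smul_one]

theorem hasDerivAt_pow_smul_matrixFun_iteratedDeriv_dslope (hU : IsOpen U)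
    (hq : AnalyticOnNhd ℂ q U) (ha : a ∈ U) {M : Matrix (Fin n) (Fin n) ℂ} {s : ℝ}
    (hs : spectrum ℂ (a • (1 : Matrix (Fin n) (Fin n) ℂ) + s • M) ⊆ U) (k : ℕ) :
    HasDerivAt
      (fun s : ℝ => s ^ (k + 1) • matrixFun (iteratedDeriv k (dslope q a)) (a • 1 + s • M))
      (s ^ k • matrixFun (iteratedDeriv (k + 1) q) (a • 1 + s • M)) s := by
  have hφ : HasDerivAt
      (fun s : ℝ => matrixFun (iteratedDeriv k (dslope q a)) (a • 1 + s • M))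
      (M * matrixFun (iteratedDeriv (k + 1) (dslope q a)) (a • 1 + s • M)) s := by
    have h := HasDerivAt.scomp s (hasDerivAt_matrixFun_smul_one_add_smul (s := s) (M := M)
      fun x hx => analyticAt_iteratedDeriv (analyticOnNhd_dslope hU hq ha x (hs hx)) k)
      Complex.ofRealCLM.hasDerivAt
    rw [iteratedDeriv_succ]
    exact h.congr_deriv (one_smul ℂ _)
  refine ((hasDerivAt_pow (k + 1) s).fun_smul hφ).congr_deriv ?_
  rw [matrixFun_iteratedDeriv_succ hU hq ha hs, add_sub_cancel_left, smul_mul_assoc,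
    Nat.add_sub_cancel, ← Nat.cast_succ, Nat.cast_smul_eq_nsmul]
  module

theorem seminorm_matrixFun_iteratedDeriv_dslope_le (p : Seminorm ℝ (Matrix (Fin n) (Fin n) ℂ))
    (hU : IsOpen U) (hq : AnalyticOnNhd ℂ q U) (ha : a ∈ U)
    {𝓑 : Set (Matrix (Fin n) (Fin n) ℂ)} (h𝓑 : StarConvex ℝ (a • 1) 𝓑)
    (h𝓑U : ∀ B ∈ 𝓑, spectrum ℂ B ⊆ U) {k : ℕ} {m : ℝ}
    (hm : ∀ B ∈ 𝓑, p (matrixFun (iteratedDeriv (k + 1) q) B) ≤ (k + 1).factorial * m)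
    {B : Matrix (Fin n) (Fin n) ℂ} (hB : B ∈ 𝓑) :
    p (matrixFun (iteratedDeriv k (dslope q a)) B) ≤ k.factorial * m := by
  have hmem : ∀ s ∈ Set.Icc (0 : ℝ) 1, a • 1 + s • (B - a • 1) ∈ 𝓑 := fun s hs =>
    h𝓑.add_smul_sub_mem hB hs.1 hs.2
  have hderiv := fun s hs => hasDerivAt_pow_smul_matrixFun_iteratedDeriv_dslope hU hq ha
    (h𝓑U _ (hmem s hs)) k
  have hbound : ∀ s : ℝ, HasDerivAt (fun s => s ^ (k + 1) * (k.factorial * m))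
      (s ^ k * ((k + 1).factorial * m)) s := fun s => by
    refine ((hasDerivAt_pow (k + 1) s).mul_const (k.factorial * m)).congr_deriv ?_
    rw [Nat.factorial_succ, Nat.add_sub_cancel]
    push_cast
    ring
  have hmain := seminorm_image_le_of_seminorm_deriv_le_deriv (continuous_seminorm p)
    (fun s hs => (hderiv s hs).continuousAt.continuousWithinAt)
    (fun s hs => (hderiv s (Set.Ico_subset_Icc_self hs)).hasDerivWithinAt)
    (by simp) (fun s _ => (hbound s).continuousAt.continuousWithinAt)
    (fun s _ => (hbound s).hasDerivWithinAt)
    (fun s hs => ?_) (Set.right_mem_Icc.2 zero_le_one)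
  · simpa using hmain
  · rw [map_smul_eq_mul, Real.norm_of_nonneg (pow_nonneg hs.1 k)]
    exact mul_le_mul_of_nonneg_left (hm _ (hmem s (Set.Ico_subset_Icc_self hs)))
      (pow_nonneg hs.1 k)

theorem seminorm_matrixFun_dividedDifference_le (p : Seminorm ℝ (Matrix (Fin n) (Fin n) ℂ))
    (hU : IsOpen U) {l : List ℂ} (hl : ∀ a ∈ l, a ∈ U) (hq : AnalyticOnNhd ℂ q U)
    {𝓑 : Set (Matrix (Fin n) (Fin n) ℂ)} (h𝓑 : ∀ a ∈ l, StarConvex ℝ (a • 1) 𝓑)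
    (h𝓑U : ∀ B ∈ 𝓑, spectrum ℂ B ⊆ U) {m : ℝ}
    (hm : ∀ B ∈ 𝓑, p (matrixFun (iteratedDeriv l.length q) B) ≤ l.length.factorial * m)
    {B : Matrix (Fin n) (Fin n) ℂ} (hB : B ∈ 𝓑) :
    p (matrixFun (dividedDifference l q) B) ≤ m := by
  induction l generalizing q with
  | nil => simpa [dividedDifference] using hm B hB
  | cons a l ih =>
    simp only [List.forall_mem_cons] at hl h𝓑
    exact ih hl.2 (analyticOnNhd_dslope hU hq hl.1) h𝓑.2 fun C hC =>
      seminorm_matrixFun_iteratedDeriv_dslope_le p hU hq hl.1 h𝓑.1 h𝓑U hm hC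

end DividedDifferenceEstimate

section ScalarJoin

/-- The matrices `(1 - t) μ 𝟏 + t A` with `t ∈ [0, 1]` and `μ ∈ S`, as the union of the segments
that join the scalar matrices `μ 𝟏` to `A`. This is the set over which the remainder is maximized;
as a `convexJoin` it is convex whenever `S` is. -/
def scalarJoin (A : Matrix (Fin n) (Fin n) ℂ) (S : Set ℂ) : Set (Matrix (Fin n) (Fin n) ℂ) :=
  convexJoin ℝ ((fun μ : ℂ => μ • (1 : Matrix (Fin n) (Fin n) ℂ)) '' S) {A}

variable {S : Set ℂ} {B : Matrix (Fin n) (Fin n) ℂ}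

theorem mem_scalarJoin : B ∈ scalarJoin A S ↔ ∃ t ∈ Set.Icc (0 : ℝ) 1, ∃ μ ∈ S,
    ((1 - (t : ℂ)) * μ) • (1 : Matrix (Fin n) (Fin n) ℂ) + (t : ℂ) • A = B := by
  have hcoe : ∀ (t : ℝ) (μ : ℂ), ((1 - (t : ℂ)) * μ) • (1 : Matrix (Fin n) (Fin n) ℂ) +
      (t : ℂ) • A = (1 - t) • μ • (1 : Matrix (Fin n) (Fin n) ℂ) + t • A := fun t μ => by
    rw [mul_smul, ← Complex.ofReal_one, ← Complex.ofReal_sub, Complex.coe_smul, Complex.coe_smul]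
  simp only [scalarJoin, mem_convexJoin, Set.mem_singleton_iff, exists_eq_left,
    segment_eq_image, Set.mem_image, hcoe]
  exact ⟨fun ⟨_, ⟨μ, hμ, rfl⟩, t, ht, h⟩ => ⟨t, ht, μ, hμ, h⟩,
    fun ⟨t, ht, μ, hμ, h⟩ => ⟨_, ⟨μ, hμ, rfl⟩, t, ht, h⟩⟩

theorem scalarJoin_eq_image (A : Matrix (Fin n) (Fin n) ℂ) (S : Set ℂ) :
    scalarJoin A S = (fun x : ℝ × ℂ =>
      ((1 - (x.1 : ℂ)) * x.2) • (1 : Matrix (Fin n) (Fin n) ℂ) + (x.1 : ℂ) • A) ''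
        Set.Icc 0 1 ×ˢ S := by
  ext B
  simp [mem_scalarJoin, and_assoc]

theorem self_mem_scalarJoin (hS : S.Nonempty) : A ∈ scalarJoin A S :=
  let ⟨μ, hμ⟩ := hS
  mem_scalarJoin.2 ⟨1, Set.right_mem_Icc.2 zero_le_one, μ, hμ, by simp⟩

theorem smul_one_mem_scalarJoin {μ : ℂ} (hμ : μ ∈ S) : μ • 1 ∈ scalarJoin A S :=
  mem_scalarJoin.2 ⟨0, Set.left_mem_Icc.2 zero_le_one, μ, hμ, by simp⟩

theorem convex_scalarJoin (A : Matrix (Fin n) (Fin n) ℂ) (hS : Convex ℝ S) :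
    Convex ℝ (scalarJoin A S) :=
  (hS.linear_image ((LinearMap.toSpanSingleton ℂ _ 1).restrictScalars ℝ)).convexJoin
    (convex_singleton A)

theorem spectrum_subset_of_mem_scalarJoin {K : Set ℂ} (hK : Convex ℝ K)
    (hAK : spectrum ℂ A ⊆ K) (hSK : S ⊆ K) (hB : B ∈ scalarJoin A S) : spectrum ℂ B ⊆ K := by
  obtain ⟨t, ht, μ, hμ, rfl⟩ := mem_scalarJoin.1 hB
  rw [spectrum_smul_one_add_smul]
  rintro _ ⟨w, hw, rfl⟩
  simpa using hK (hSK hμ) (hAK hw) (sub_nonneg.2 ht.2) ht.1 (sub_add_cancel 1 t)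

theorem exists_isGreatest_image_matrixFun_scalarJoin {φ : Matrix (Fin n) (Fin n) ℂ → ℝ}
    (hφ : Continuous φ) (hS : IsCompact S) (hne : S.Nonempty)
    (hg : ∀ B ∈ scalarJoin A S, AnalyticOnNhd ℂ g (spectrum ℂ B)) :
    ∃ m, IsGreatest ((fun B => φ (matrixFun g B)) '' scalarJoin A S) m := by
  rw [scalarJoin_eq_image] at hg ⊢
  rw [Set.image_image]
  refine ((isCompact_Icc.prod hS).image_of_continuousOn (hφ.comp_continuousOn ?_)).exists_isGreatest
    (((Set.nonempty_Icc.2 zero_le_one).prod hne).image _)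
  refine (continuousOn_matrixFun_smul_one_add_smul A g).comp
    (f := fun x : ℝ × ℂ => ((1 - (x.1 : ℂ)) * x.2, (x.1 : ℂ))) (by fun_prop) fun x hx w hw => ?_
  refine hg _ (Set.mem_image_of_mem _ hx) _ ?_
  rw [spectrum_smul_one_add_smul]
  exact Set.mem_image_of_mem _ hw

end ScalarJoin

end FunctionalCalculus

section Interpolation

variable {N : ℕ}

theorem count_ofFn_eq_nodeMultiplicity (z : Fin N → ℂ) (k : Fin N) :
    (List.ofFn z).count (z k) = nodeMultiplicity z k := by
  classical
  rw [nodeMultiplicity, Nat.card_eq_fintype_card, Fintype.card_subtype, ← Multiset.coe_count,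
    ← Fin.univ_val_map, Multiset.count_map]
  simp only [eq_comm (a := z k)]
  rfl

theorem prod_ofFn_sub_eq_eval_nodePoly (z : Fin N → ℂ) (x : ℂ) :
    ((List.ofFn z).map fun a => x - a).prod = (nodePoly z).eval x := by
  rw [List.map_ofFn, List.prod_ofFn, nodePoly, Polynomial.eval_prod]
  simp

theorem iteratedDeriv_eval (p : Polynomial ℂ) (k : ℕ) :
    iteratedDeriv k (fun x => p.eval x) = fun x => (Polynomial.derivative^[k] p).eval x := by
  induction k with
  | zero => simp
  | succ k ih =>
    rw [iteratedDeriv_succ, ih, Function.iterate_succ_apply']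
    exact funext fun x => Polynomial.deriv _

theorem iteratedDeriv_sub_eval {g : ℂ → ℂ} {x : ℂ} (hg : AnalyticAt ℂ g x) {u : Polynomial ℂ}
    (hu : u.natDegree < N) :
    iteratedDeriv N (fun y => g y - u.eval y) x = iteratedDeriv N g x := by
  rw [iteratedDeriv_fun_sub hg.contDiffAt (analyticOnNhd_eval u {x} x rfl).contDiffAt,
    iteratedDeriv_eval, Polynomial.iterate_derivative_eq_zero hu]
  simp

theorem Interpolates.count_le_analyticOrderAt {z : Fin N → ℂ} {f : ℂ → ℂ} {u v : Polynomial ℂ}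
    (hr : Interpolates z (fun x => u.eval x / v.eval x) f) {k : Fin N}
    (hf : AnalyticAt ℂ f (z k)) (hv : v.eval (z k) ≠ 0) :
    ((List.ofFn z).count (z k) : ℕ∞) ≤
      analyticOrderAt (fun x => v.eval x * f x - u.eval x) (z k) := by
  have hva := analyticOnNhd_eval v {z k} (z k) rfl
  have hra : AnalyticAt ℂ (fun x => u.eval x / v.eval x) (z k) :=
    (analyticOnNhd_eval u {z k} (z k) rfl).div hva hv
  have hsub : AnalyticAt ℂ (fun x => f x - u.eval x / v.eval x) (z k) := hf.sub hra
  have hfac : (fun x => v.eval x * f x - u.eval x) =ᶠ[𝓝 (z k)]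
      (fun x => v.eval x) * (fun x => f x - u.eval x / v.eval x) := by
    filter_upwards [hva.continuousAt.eventually_ne hv] with x hx
    rw [Pi.mul_apply, mul_sub, mul_div_cancel₀ _ hx]
  rw [analyticOrderAt_congr hfac, analyticOrderAt_mul hva hsub]
  refine le_trans ?_ le_add_self
  rw [natCast_le_analyticOrderAt_iff_iteratedDeriv_eq_zero hsub, count_ofFn_eq_nodeMultiplicity]
  intro j hj
  rw [iteratedDeriv_fun_sub hf.contDiffAt hra.contDiffAt, sub_eq_zero]
  exact (hr k j hj).symm

theorem seminorm_matrixFun_sub_matrixFun_div_le {n : ℕ} {A : Matrix (Fin n) (Fin n) ℂ}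
    {z : Fin N → ℂ} {U : Set ℂ} {f : ℂ → ℂ} {u v : Polynomial ℂ} (hU : IsOpen U)
    (hf : AnalyticOnNhd ℂ f U) (hzU : ∀ k, z k ∈ U) (hvz : ∀ k, v.eval (z k) ≠ 0)
    (hvA : ∀ w ∈ spectrum ℂ A, v.eval w ≠ 0)
    (hr : Interpolates z (fun x => u.eval x / v.eval x) f)
    (ν : Seminorm ℝ (Matrix (Fin n) (Fin n) ℂ)) {𝓑 : Set (Matrix (Fin n) (Fin n) ℂ)}
    (h𝓑 : ∀ k, StarConvex ℝ (z k • 1) 𝓑) (h𝓑U : ∀ B ∈ 𝓑, spectrum ℂ B ⊆ U) (hA : A ∈ 𝓑) {m : ℝ}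
    (hm : ∀ B ∈ 𝓑, ν (Polynomial.aeval A (nodePoly z) * (Polynomial.aeval A v)⁻¹ *
      matrixFun (iteratedDeriv N fun x => v.eval x * f x - u.eval x) B) ≤ N.factorial * m) :
    ν (matrixFun f A - matrixFun (fun x => u.eval x / v.eval x) A) ≤ m := by
  set L := Polynomial.aeval A (nodePoly z) * (Polynomial.aeval A v)⁻¹
  have hq : AnalyticOnNhd ℂ (fun x => v.eval x * f x - u.eval x) U :=
    ((analyticOnNhd_eval v U).mul hf).sub (analyticOnNhd_eval u U)
  have hlU : ∀ a ∈ List.ofFn z, a ∈ U := by simpa [List.mem_ofFn] using hzU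
  have hfactor : ∀ x, v.eval x * f x - u.eval x = (nodePoly z).eval x *
      dividedDifference (List.ofFn z) (fun x => v.eval x * f x - u.eval x) x := fun x => by
    rw [← prod_ofFn_sub_eq_eval_nodePoly]
    refine eq_prod_mul_dividedDifference hU hlU hq (fun a ha => ?_) x
    obtain ⟨k, rfl⟩ := (List.mem_ofFn' z a).1 ha
    exact hr.count_le_analyticOrderAt (hf _ (hzU k)) (hvz k)
  rw [matrixFun_sub_div_eq (fun w hw => hf w (h𝓑U A hA hw))
    (fun w hw => analyticOnNhd_dividedDifference hU hlU hq w (h𝓑U A hA hw)) hvA hfactor]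
  exact seminorm_matrixFun_dividedDifference_le (ν.comp (LinearMap.mulLeft ℝ L)) hU hlU hq
    (by simpa [List.mem_ofFn] using h𝓑) h𝓑U (by simpa using hm) hA

theorem seminorm_remainderMatrix {n : ℕ} (ν : Seminorm ℝ (Matrix (Fin n) (Fin n) ℂ))
    (A : Matrix (Fin n) (Fin n) ℂ) (z : Fin N → ℂ) (v : Polynomial ℂ) (f : ℂ → ℂ) (t : ℝ) (μ : ℂ) :
    ν (remainderMatrix A z v f t μ) = (N.factorial : ℝ)⁻¹ *
      ν (Polynomial.aeval A (nodePoly z) * (Polynomial.aeval A v)⁻¹ *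
        matrixFun (iteratedDeriv N fun x => v.eval x * f x)
          (((1 - (t : ℂ)) * μ) • (1 : Matrix (Fin n) (Fin n) ℂ) + (t : ℂ) • A)) := by
  have hcoe : (N.factorial : ℂ)⁻¹ = ((N.factorial : ℝ)⁻¹ : ℝ) := by push_cast; rfl
  rw [remainderMatrix, mul_smul_comm, hcoe, Complex.coe_smul, map_smul_eq_mul,
    Real.norm_of_nonneg (by positivity)]

theorem exists_isGreatest_seminorm_remainderMatrix {n : ℕ}
    (ν : Seminorm ℝ (Matrix (Fin n) (Fin n) ℂ)) {A : Matrix (Fin n) (Fin n) ℂ} (z : Fin N → ℂ)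
    {v : Polynomial ℂ} {f : ℂ → ℂ} {S : Set ℂ} (hS : IsCompact S) (hne : S.Nonempty)
    (hvf : ∀ B ∈ scalarJoin A S, AnalyticOnNhd ℂ (fun x => v.eval x * f x) (spectrum ℂ B)) :
    ∃ m, IsGreatest {x : ℝ | ∃ t ∈ Set.Icc (0 : ℝ) 1, ∃ μ ∈ S,
      x = ν (remainderMatrix A z v f t μ)} m := by
  obtain ⟨m, hm⟩ := exists_isGreatest_image_matrixFun_scalarJoin
    (φ := fun X => (N.factorial : ℝ)⁻¹ *
      ν (Polynomial.aeval A (nodePoly z) * (Polynomial.aeval A v)⁻¹ * X))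
    (continuous_const.mul ((continuous_seminorm ν).comp (by fun_prop))) hS hne
    fun B hB x hx => analyticAt_iteratedDeriv (hvf B hB x hx) N
  refine ⟨m, ?_⟩
  convert hm using 1
  ext x
  simp [mem_scalarJoin, seminorm_remainderMatrix, @eq_comm ℝ x]

end Interpolation

end MatrixEstimate

open MatrixEstimate in
theorem corollaryc_general {n N : ℕ} (A : Matrix (Fin n) (Fin n) ℂ) (z : Fin N → ℂ)
    (U : Set ℂ) (hU : IsOpen U) (hAU : convexHull ℝ (spectrum ℂ A ∪ Set.range z) ⊆ U)
    (f : ℂ → ℂ) (hf : AnalyticOnNhd ℂ f U)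
    (u v : Polynomial ℂ) (hu : u.natDegree < N)
    (hvz : ∀ k, v.eval (z k) ≠ 0) (hvA : ∀ w ∈ spectrum ℂ A, v.eval w ≠ 0)
    (hr : Interpolates z (fun x => u.eval x / v.eval x) f)
    (ν : Seminorm ℝ (Matrix (Fin n) (Fin n) ℂ)) :
    ∃ m : ℝ,
      IsGreatest {x : ℝ | ∃ t ∈ Set.Icc (0 : ℝ) 1, ∃ μ ∈ convexHull ℝ (Set.range z),
        x = ν (remainderMatrix A z v f t μ)} m ∧
      ν (matrixFun f A - matrixFun (fun x => u.eval x / v.eval x) A) ≤ m := by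
  set S := convexHull ℝ (Set.range z)
  have hzS : ∀ k, z k ∈ S := fun k => subset_convexHull ℝ _ ⟨k, rfl⟩
  have hS : S.Nonempty := ⟨_, hzS ⟨0, by omega⟩⟩
  have hSU : S ⊆ U := (convexHull_mono Set.subset_union_right).trans hAU
  have hBU : ∀ B ∈ scalarJoin A S, spectrum ℂ B ⊆ U := fun B hB =>
    (spectrum_subset_of_mem_scalarJoin (convex_convexHull ℝ _)
      (Set.subset_union_left.trans (subset_convexHull ℝ _))
      (convexHull_mono Set.subset_union_right) hB).trans hAU
  have hvf : AnalyticOnNhd ℂ (fun x => v.eval x * f x) U := (analyticOnNhd_eval v U).mul hf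
  obtain ⟨m, hm⟩ := exists_isGreatest_seminorm_remainderMatrix ν z
    ((Set.finite_range z).isCompact_convexHull ℝ) hS fun B hB => hvf.mono (hBU B hB)
  refine ⟨m, hm, seminorm_matrixFun_sub_matrixFun_div_le hU hf (fun k => hSU (hzS k)) hvz hvA hr ν
    (fun k => convex_scalarJoin A (convex_convexHull ℝ _) (smul_one_mem_scalarJoin (hzS k)))
    hBU (self_mem_scalarJoin hS) fun B hB => ?_⟩
  have hderiv : matrixFun (iteratedDeriv N fun x => v.eval x * f x - u.eval x) B =
      matrixFun (iteratedDeriv N fun x => v.eval x * f x) B := by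
    refine (matrixFun_congr (fun x hx => analyticAt_iteratedDeriv (hvf x (hBU B hB hx)) N)
      fun x hx => ?_).symm
    filter_upwards [hU.mem_nhds (hBU B hB hx)] with y hy
    exact (iteratedDeriv_sub_eval (hvf y hy) hu).symm
  obtain ⟨t, ht, μ, hμ, rfl⟩ := mem_scalarJoin.1 hB
  rw [hderiv, ← inv_mul_le_iff₀ (by positivity), ← seminorm_remainderMatrix]
  exact hm.2 ⟨t, ht, μ, hμ, rfl⟩

theorem corollaryc {n N : ℕ} (A : Matrix (Fin n) (Fin n) ℂ) (z : Fin N → ℂ)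
    (U : Set ℂ) (hU : IsOpen U) (hAU : convexHull ℝ (spectrum ℂ A ∪ Set.range z) ⊆ U)
    (f : ℂ → ℂ) (hf : AnalyticOnNhd ℂ f U)
    (u v : Polynomial ℂ) (hu : u.natDegree < N)
    (hvz : ∀ k, v.eval (z k) ≠ 0) (hvA : ∀ w ∈ spectrum ℂ A, v.eval w ≠ 0)
    (hr : MatrixEstimate.Interpolates z (fun x => u.eval x / v.eval x) f)
    -- an arbitrary norm on the space of matrices
    (ν : Seminorm ℂ (Matrix (Fin n) (Fin n) ℂ)) (hν : ∀ M, ν M = 0 → M = 0) :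
    ∃ m : ℝ,
      IsGreatest {x : ℝ | ∃ t ∈ Set.Icc (0 : ℝ) 1, ∃ μ ∈ convexHull ℝ (Set.range z),
        x = ν (MatrixEstimate.remainderMatrix A z v f t μ)} m ∧
      ν (MatrixEstimate.matrixFun f A -
        MatrixEstimate.matrixFun (fun x => u.eval x / v.eval x) A) ≤ m :=
  corollaryc_general A z U hU hAU f hf u v hu hvz hvA hr (ν.restrictScalars ℝ)
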